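/- Let $\mathcal P$ be the plane $\mathbb R^2$ with a norm whose unit circle is a smooth, quadratically convex (smooth with nowhere vanishing Euclidean curvature) closed curve, symmetric about the origin. Write $[x,y]$ for the determinant of two vectors, $e(\varphi)=(\cos\varphi,\sin\varphi)$, and let $p:\mathbb R\to\mathbb R^2$ be the smooth parametrization of the unit circle by its tangent angle: $p'(\varphi)$ is a positive multiple of $e(\varphi)$, $p(\varphi+\pi)=-p(\varphi)$, and $[p,p']>0$. Let $q=p'/[p,p']$ be the dual parametrization. The class $\mathcal H$ consists of the smooth (possibly singular) plane curves $\gamma$ together with a smooth angle function $\theta$ such that $[e(\theta(t)),\gamma'(t)]=0$ and $\theta'(t)\neq0$ for all $t$, i.e. fronts whose Legendrian lift $\nu(t)=\mathbb R\,e(\theta(t))\in \mathrm P\mathbb R^1$ is immersed. Such a curve is closed if, for some $T>0$, $\gamma(t+T)=\gamma(t)$ and $|\theta(t+T)-\theta(t)|=2\pi$ for all $t$ (it closes after one full turn of its tangent). Its support function is $h(t)=[\gamma(t),q(\theta(t))]$, and $\gamma$ has constant width if there is a constant $c$ with $h(s)+h(t)=c$ whenever $\theta(t)=\theta(s)+\pi$;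 when $\theta$ is used as the parameter, this reads $h(\theta)+h(\theta+\pi)=c$. The curvature radius $r$ of $\gamma$ is defined by $\gamma'(t)=r(t)\,\frac{d}{dt}\,p(\theta(t))$, and a vertex of $\gamma$ is a parameter value $t$ with $r'(t)=0$. **Theorem (six vertices theorem).** Let $\gamma\in\mathcal H$ be a closed curve with constant width. Then its curvature radius $r$ is a well-defined smooth function and $\gamma$ has at least six vertices, i.e. there are at least six distinct $t\in[0,T)$ with $r'(t)=0$. -/

import Mathlib

open scoped ContDiff

noncomputable section

namespace NormedPlane

/-- The determinant `[x, y]` of a pair of vectors of the plane. -/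
def det (x y : ℝ × ℝ) : ℝ := x.1 * y.2 - x.2 * y.1

/-- The Euclidean unit vector making the angle `φ` with the first coordinate axis. -/
def dir (φ : ℝ) : ℝ × ℝ := (Real.cos φ, Real.sin φ)

/-- `N` is a norm on the plane whose unit circle is smooth, quadratically convex and symmetric,
and `p` is the parametrization of this unit circle by the angle `φ` that its tangent makes with
the first axis.  That the derivative of `p` with respect to the tangent angle exists and does not
vanish says that the unit circle is smooth with nowhere vanishing Euclidean curvature. -/
structure IsUnitCircle (N : Seminorm ℝ (ℝ × ℝ)) (p : ℝ → ℝ × ℝ) : Prop where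
  definite : ∀ x, N x = 0 → x = 0
  smooth : ContDiff ℝ ∞ p
  range_eq : Set.range p = {x | N x = 1}
  antipodal : ∀ φ, p (φ + Real.pi) = -p φ
  tangent : ∀ φ, ∃ ρ : ℝ, 0 < ρ ∧ deriv p φ = ρ • dir φ
  counterclockwise : ∀ φ, 0 < det (p φ) (deriv p φ)

/-- The dual parametrization `q = p' / [p, p']`. -/
def dualParam (p : ℝ → ℝ × ℝ) (φ : ℝ) : ℝ × ℝ :=
  (det (p φ) (deriv p φ))⁻¹ • deriv p φ

/-- `γ` is a front without inflections (a member of the class `ℋ`).  The Legendrian lift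
`ν : ℝ → P ℝ¹` is given by a smooth angle function `θ`, that is, `ν t` is the line spanned by
`dir (θ t)`; it satisfies `[ν, γ'] = 0` and `ν' ≠ 0`.  The curve `γ` may be singular. -/
structure IsFront (γ : ℝ → ℝ × ℝ) (θ : ℝ → ℝ) : Prop where
  smooth : ContDiff ℝ ∞ γ
  smooth_angle : ContDiff ℝ ∞ θ
  legendrian : ∀ t, det (dir (θ t)) (deriv γ t) = 0
  angle_deriv_ne_zero : ∀ t, deriv θ t ≠ 0

/-- The front `γ` closes up, with period `T`, after one full turn (in either direction) of its
tangent line. -/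
structure IsClosedFront (γ : ℝ → ℝ × ℝ) (θ : ℝ → ℝ) (T : ℝ) : Prop extends IsFront γ θ where
  period_pos : 0 < T
  periodic : Function.Periodic γ T
  one_turn : ∀ t, |θ (t + T) - θ t| = 2 * Real.pi

/-- The support function `h = [γ, q]`. -/
def supportFunction (p : ℝ → ℝ × ℝ) (γ : ℝ → ℝ × ℝ) (θ : ℝ → ℝ) (t : ℝ) : ℝ :=
  det (γ t) (dualParam p (θ t))

/-- Constant width: the sum of the values of the support function at two points with opposite
tangent directions is constant.  When the curve is parametrized by the tangent angle `φ`, this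
is `h φ + h (φ + π) = c`. -/
def HasConstantWidth (p : ℝ → ℝ × ℝ) (γ : ℝ → ℝ × ℝ) (θ : ℝ → ℝ) : Prop :=
  ∃ c : ℝ, ∀ s t, θ t = θ s + Real.pi →
    supportFunction p γ θ s + supportFunction p γ θ t = c

/-- `r` is the curvature radius of `γ`: the velocity of `γ` is `r` times the velocity of the
point of the unit circle with the same tangent angle. -/
def IsCurvatureRadius (p : ℝ → ℝ × ℝ) (γ : ℝ → ℝ × ℝ) (θ : ℝ → ℝ) (r : ℝ → ℝ) : Prop :=
  ∀ t, deriv γ t = r t • deriv (fun s => p (θ s)) t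

/-- The vertices, as parameter values in one period: the zeros of the derivative of the curvature
radius `r`. -/
def vertices (r : ℝ → ℝ) (T : ℝ) : Set ℝ :=
  {t | t ∈ Set.Ico 0 T ∧ deriv r t = 0}

end NormedPlane

end

/-!
Use the tangent angle `x` as parameter. Constant width `c` then means `γ x - γ (x + π) = c • p x`,
whence `r x + r (x + π) = c`, so `r'` is `π`-antiperiodic. Integrating by parts over
`[a, a + π]`, where `[p a, p]` vanishes at both ends and is positive inside,
`∫ r' [p a, p] = -∫ r [p a, p'] = [p a, γ a - γ (a + π)] = c [p a, p a] = 0`.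
Hence `r'` either vanishes on some half turn or takes both signs on every half turn. In the second
case start at a zero `a` after which `r'` changes sign at some `b` in `(a, a + π)`: if there were
no other zero in `(a, a + π)`, antiperiodicity would make the sign of `r'` constant on
`(b, a + π)` and, the same, on `(a + π, b + π)`, that is, on the half turn starting at `b`.
Three zeros on a half turn give six on the full turn.
-/

namespace NormedPlane

open Real Set Function

theorem exists_three_zeros_of_forall_exists_neg {f : ℝ → ℝ} {T : ℝ} (hf : Continuous f)
    (hanti : f.Antiperiodic T) (hneg : ∀ a, ∃ x ∈ Ioo a (a + T), f x < 0) :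
    ∃ a b c, a < b ∧ b < c ∧ c < a + T ∧ f a = 0 ∧ f b = 0 ∧ f c = 0 := by
  have hpos (a : ℝ) : ∃ x ∈ Ioo a (a + T), 0 < f x := by
    obtain ⟨x, hx, hfx⟩ := hneg (a + T)
    exact ⟨x - T, ⟨by linarith [hx.1], by linarith [hx.2]⟩, by rw [hanti.sub_eq]; linarith⟩
  have exists_zero {s : Set ℝ} (hs : IsPreconnected s) {x y : ℝ} (hx : x ∈ s) (hy : y ∈ s)
      (hfx : f x < 0) (hfy : 0 < f y) : ∃ z ∈ s, f z = 0 :=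
    hs.intermediate_value hx hy hf.continuousOn ⟨hfx.le, hfy.le⟩
  obtain ⟨a, x, y, hax, hxy, hya, hfa, hfx, hfy⟩ :
      ∃ a x y, a < x ∧ x < y ∧ y < a + T ∧ f a = 0 ∧ f x < 0 ∧ 0 < f y := by
    obtain ⟨x₀, -, hx₀⟩ := hneg 0
    obtain ⟨y₀, -, hy₀⟩ := hpos 0
    obtain ⟨a, -, hfa⟩ := exists_zero isPreconnected_univ (mem_univ x₀) (mem_univ y₀) hx₀ hy₀
    obtain ⟨x, hx, hfx⟩ := hneg a
    obtain ⟨y, hy, hfy⟩ := hpos a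
    rcases lt_trichotomy x y with hxy | rfl | hyx
    · exact ⟨a, x, y, hx.1, hxy, hy.2, hfa, hfx, hfy⟩
    · exact absurd hfx hfy.not_gt
    · refine ⟨a + T, y + T, x + T, by linarith [hy.1], by linarith, by linarith [hx.2], ?_, ?_, ?_⟩
      all_goals rw [hanti]; linarith
  obtain ⟨b, ⟨hxb, hby⟩, hfb⟩ := intermediate_value_Ioo hxy.le hf.continuousOn ⟨hfx, hfy⟩
  obtain ⟨z, ⟨hbz, hzb⟩, hfz⟩ := hneg b
  rcases lt_trichotomy z (a + T) with hz | rfl | hz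
  · obtain ⟨c, ⟨hbc, hca⟩, hfc⟩ :=
      exists_zero (s := Ioo b (a + T)) isPreconnected_Ioo ⟨hbz, hz⟩ ⟨hby, hya⟩ hfz hfy
    exact ⟨a, b, c, hax.trans hxb, hbc, hca, hfa, hfb, hfc⟩
  · rw [hanti, hfa, neg_zero] at hfz
    exact absurd hfz (lt_irrefl 0)
  · have hfz' : 0 < f (z - T) := by rw [hanti.sub_eq]; linarith
    obtain ⟨c, ⟨hac, hcb⟩, hfc⟩ :=
      exists_zero (s := Ioo a b) isPreconnected_Ioo ⟨hax, hxb⟩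
        ⟨by linarith, by linarith⟩ hfx hfz'
    exact ⟨a, c, b, hac, hcb, hby.trans hya, hfa, hfc, hfb⟩

theorem eq_zero_of_nonneg_of_integral_mul_eq_zero {f g : ℝ → ℝ} {a b : ℝ}
    (hf : ContinuousOn f (Icc a b)) (hg : ContinuousOn g (Icc a b))
    (hf0 : ∀ x ∈ Ioo a b, 0 ≤ f x) (hg0 : ∀ x ∈ Ioo a b, 0 < g x)
    (hfg : ∫ x in a..b, f x * g x = 0) : ∀ x ∈ Ioo a b, f x = 0 := by
  intro x hx
  by_contra hfx
  have hab : a < b := hx.1.trans hx.2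
  have hnonneg : ∀ y ∈ Icc a b, 0 ≤ f y * g y := by
    rw [← closure_Ioo hab.ne] at hf hg ⊢
    exact le_on_closure (fun y hy => mul_nonneg (hf0 y hy) (hg0 y hy).le) continuousOn_const
      (hf.mul hg)
  have hposx : 0 < f x * g x := mul_pos ((hf0 x hx).lt_of_ne' hfx) (hg0 x hx)
  exact (intervalIntegral.integral_pos hab (hf.mul hg)
    (fun y hy => hnonneg y (Ioc_subset_Icc_self hy)) ⟨x, Ioo_subset_Icc_self hx, hposx⟩).ne' hfg

theorem exists_three_zeros_of_integral_mul_eq_zero {f : ℝ → ℝ} {g : ℝ → ℝ → ℝ} {T : ℝ}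
    (hT : 0 < T) (hf : Continuous f) (hanti : f.Antiperiodic T)
    (hg : ∀ a, ContinuousOn (g a) (Icc a (a + T))) (hg0 : ∀ a, ∀ x ∈ Ioo a (a + T), 0 < g a x)
    (hfg : ∀ a, ∫ x in a..(a + T), f x * g a x = 0) :
    ∃ a b c, a < b ∧ b < c ∧ c < a + T ∧ f a = 0 ∧ f b = 0 ∧ f c = 0 := by
  by_cases hneg : ∀ a, ∃ x ∈ Ioo a (a + T), f x < 0
  · exact exists_three_zeros_of_forall_exists_neg hf hanti hneg
  · push Not at hneg
    obtain ⟨a, ha⟩ := hneg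
    have hzero := eq_zero_of_nonneg_of_integral_mul_eq_zero hf.continuousOn (hg a) ha (hg0 a)
      (hfg a)
    exact ⟨a + T / 4, a + T / 2, a + 3 * T / 4, by linarith, by linarith, by linarith,
      hzero _ ⟨by linarith, by linarith⟩, hzero _ ⟨by linarith, by linarith⟩,
      hzero _ ⟨by linarith, by linarith⟩⟩

theorem six_le_encard_zeros_of_antiperiodic {f : ℝ → ℝ} {T a b c : ℝ} (hanti : f.Antiperiodic T)
    (hab : a < b) (hbc : b < c) (hca : c < a + T) (ha : f a = 0) (hb : f b = 0) (hc : f c = 0) :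
    6 ≤ (Ico a (a + 2 * T) ∩ f ⁻¹' {0}).encard := by
  let v : Fin 6 → ℝ := ![a, b, c, a + T, b + T, c + T]
  have hv : StrictMono v := by
    rw [Fin.strictMono_iff_lt_succ]
    intro i
    fin_cases i <;> simp [v, hab, hbc, hca]
  have hv0 (i : Fin 6) : f (v i) = 0 := by
    fin_cases i <;> simp [v, hanti a, hanti b, hanti c, ha, hb, hc]
  have hmem (i : Fin 6) : v i ∈ Ico a (a + 2 * T) :=
    ⟨hv.monotone (Fin.zero_le i), (hv.monotone (Fin.le_last i)).trans_lt
      (show c + T < a + 2 * T by linarith)⟩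
  calc (6 : ℕ∞) = ENat.card (Fin 6) := by simp
    _ ≤ (range v).encard := hv.injective.encard_range
    _ ≤ (Ico a (a + 2 * T) ∩ f ⁻¹' {0}).encard :=
        encard_le_encard (range_subset_iff.2 fun i => ⟨hmem i, hv0 i⟩)

theorem encard_Ico_inter_preimage_le_of_surjective {α : Type*} {f : ℝ → α} {θ : ℝ → ℝ}
    {T L : ℝ} {n : ℤ} (hT : 0 < T) (hL : 0 < L) (hf : f.Periodic L) (hθ : Surjective θ)
    (hturn : ∀ t, θ (t + T) = θ t + n • L) (s : Set α) (a b : ℝ) :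
    (Ico a (a + L) ∩ f ⁻¹' s).encard ≤ (Ico b (b + T) ∩ (f ∘ θ) ⁻¹' s).encard := by
  suffices h : Ico a (a + L) ∩ f ⁻¹' s ⊆
      (fun t => toIcoMod hL a (θ t)) '' (Ico b (b + T) ∩ (f ∘ θ) ⁻¹' s) from
    (encard_le_encard h).trans (encard_image_le _ _)
  rintro x ⟨hx, hfx⟩
  obtain ⟨t, rfl⟩ := hθ x
  have hmod : θ (toIcoMod hT b t) = θ t - (toIcoDiv hT b t * n) • L := by
    have hadd := AddConstMapClass.map_add_zsmul (AddConstMap.mk θ hturn) (toIcoMod hT b t)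
      (toIcoDiv hT b t)
    rw [toIcoMod_add_toIcoDiv_zsmul, ← mul_smul] at hadd
    exact eq_sub_of_add_eq hadd.symm
  refine ⟨toIcoMod hT b t, ⟨toIcoMod_mem_Ico hT b t, ?_⟩, ?_⟩
  · rw [mem_preimage, comp_apply, hmod, hf.sub_zsmul_eq]
    exact hfx
  · beta_reduce
    rw [hmod, toIcoMod_sub_zsmul]
    exact (toIcoMod_eq_self hL).2 hx

theorem surjective_of_map_add_eq {θ : ℝ → ℝ} {T d : ℝ} (hθ : Continuous θ) (hd : d ≠ 0)
    (h : ∀ t, θ (t + T) = θ t + d) : Surjective θ := by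
  intro y
  have hmap (k : ℤ) : θ (k • T) = θ 0 + k • d := by
    simpa using AddConstMapClass.map_add_zsmul (AddConstMap.mk θ h) 0 k
  have hy : y - θ 0 ∈ uIcc (⌊(y - θ 0) / d⌋ • d) (⌈(y - θ 0) / d⌉ • d) := by
    rw [zsmul_eq_mul, zsmul_eq_mul, ← image_mul_const_uIcc]
    exact ⟨(y - θ 0) / d, Icc_subset_uIcc (mem_Icc.2 ⟨Int.floor_le _, Int.le_ceil _⟩),
      div_mul_cancel₀ _ hd⟩
  have hy' : y ∈ uIcc (θ (⌊(y - θ 0) / d⌋ • T)) (θ (⌈(y - θ 0) / d⌉ • T)) := by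
    rw [hmap, hmap, ← image_const_add_uIcc]
    exact ⟨y - θ 0, hy, add_sub_cancel _ _⟩
  obtain ⟨t, -, ht⟩ := intermediate_value_uIcc hθ.continuousOn hy'
  exact ⟨t, ht⟩

theorem injective_of_deriv_ne_zero {θ : ℝ → ℝ} (hθ : Continuous θ) (h0 : ∀ t, deriv θ t ≠ 0) :
    Injective θ := by
  intro s t hst
  by_contra hne
  wlog hlt : s < t generalizing s t
  · exact this hst.symm (Ne.symm hne) ((lt_or_gt_of_ne hne).resolve_left hlt)
  · obtain ⟨x, -, hx⟩ := exists_deriv_eq_zero hlt hθ.continuousOn hst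
    exact h0 x hx

theorem exists_contDiff_inverse {θ : ℝ → ℝ} {n : WithTop ℕ∞} (hn : n ≠ 0) (hθ : ContDiff ℝ n θ)
    (h0 : ∀ t, deriv θ t ≠ 0) (hsurj : Surjective θ) :
    ∃ ψ : ℝ → ℝ, ContDiff ℝ n ψ ∧ LeftInverse ψ θ ∧ RightInverse ψ θ := by
  have hopen : IsOpenMap θ :=
    isOpenMap_of_hasStrictDerivAt (fun t => hθ.contDiffAt.hasStrictDerivAt hn) h0
  let e : ℝ ≃ₜ ℝ := (Equiv.ofBijective θ
    ⟨injective_of_deriv_ne_zero hθ.continuous h0, hsurj⟩).toHomeomorphOfContinuousOpen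
      hθ.continuous hopen
  exact ⟨e.symm, e.contDiff_symm_deriv h0 (fun t => (hθ.differentiable hn t).hasDerivAt) hθ,
    e.symm_apply_apply, e.apply_symm_apply⟩

section Det

theorem det_self (u : ℝ × ℝ) : det u u = 0 := by
  simp only [det]; ring

theorem det_sub_left (u v w : ℝ × ℝ) : det (u - v) w = det u w - det v w := by
  simp only [det, Prod.fst_sub, Prod.snd_sub]; ring

theorem det_sub_right (u v w : ℝ × ℝ) : det u (v - w) = det u v - det u w := by
  simp only [det, Prod.fst_sub, Prod.snd_sub]; ring

theorem det_smul_left (k : ℝ) (u v : ℝ × ℝ) : det (k • u) v = k * det u v := by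
  simp only [det, Prod.smul_fst, Prod.smul_snd, smul_eq_mul]; ring

theorem det_smul_right (k : ℝ) (u v : ℝ × ℝ) : det u (k • v) = k * det u v := by
  simp only [det, Prod.smul_fst, Prod.smul_snd, smul_eq_mul]; ring

theorem det_swap (u v : ℝ × ℝ) : det v u = -det u v := by
  simp only [det]; ring

theorem det_neg_right (u v : ℝ × ℝ) : det u (-v) = -det u v := by
  simp only [det, Prod.fst_neg, Prod.snd_neg]; ring

theorem det_smul_eq_cramer (u v w : ℝ × ℝ) : det u v • w = det u w • v - det v w • u := by
  ext <;> simp only [det, Prod.smul_fst, Prod.smul_snd, Prod.fst_sub, Prod.snd_sub, smul_eq_mul] <;>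
    ring

theorem det_dir_dir (x y : ℝ) : det (dir x) (dir y) = sin (y - x) := by
  rw [sin_sub, det, dir, dir]; ring

theorem eq_zero_of_det_eq_zero {u v w : ℝ × ℝ} (huv : det u v ≠ 0) (hu : det u w = 0)
    (hv : det v w = 0) : w = 0 := by
  have hcramer := det_smul_eq_cramer u v w
  rw [hu, hv, zero_smul, zero_smul, sub_zero] at hcramer
  exact (smul_eq_zero.1 hcramer).resolve_left huv

theorem hasDerivAt_det {u v : ℝ → ℝ × ℝ} {u' v' : ℝ × ℝ} {x : ℝ} (hu : HasDerivAt u u' x)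
    (hv : HasDerivAt v v' x) :
    HasDerivAt (fun y => det (u y) (v y)) (det u' (v x) + det (u x) v') x := by
  have hu₁ : HasDerivAt (fun y => (u y).1) u'.1 x := hu.fst
  have hu₂ : HasDerivAt (fun y => (u y).2) u'.2 x := hu.snd
  have hv₁ : HasDerivAt (fun y => (v y).1) v'.1 x := hv.fst
  have hv₂ : HasDerivAt (fun y => (v y).2) v'.2 x := hv.snd
  refine ((hu₁.mul hv₂).sub (hu₂.mul hv₁)).congr_deriv ?_
  simp only [det]; ring

theorem hasDerivAt_det_const_left (u : ℝ × ℝ) {v : ℝ → ℝ × ℝ} {v' : ℝ × ℝ} {x : ℝ}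
    (hv : HasDerivAt v v' x) : HasDerivAt (fun y => det u (v y)) (det u v') x :=
  (hasDerivAt_det (hasDerivAt_const x u) hv).congr_deriv (by simp [det])

theorem contDiff_det {u v : ℝ → ℝ × ℝ} {n : WithTop ℕ∞} (hu : ContDiff ℝ n u)
    (hv : ContDiff ℝ n v) : ContDiff ℝ n (fun x => det (u x) (v x)) :=
  (hu.fst.mul hv.snd).sub (hu.snd.mul hv.fst)

theorem hasDerivAt_dir (x : ℝ) : HasDerivAt dir (dir (x + π / 2)) x :=
  ((hasDerivAt_cos x).prodMk (hasDerivAt_sin x)).congr_deriv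
    (by simp [dir, cos_add_pi_div_two, sin_add_pi_div_two])

theorem eq_zero_of_det_dir_eq_zero {E : ℝ → ℝ × ℝ} {k : ℝ → ℝ}
    (hE : ∀ x, HasDerivAt E (k x • dir x) x) (hdet : ∀ x, det (dir x) (E x) = 0) : E = 0 := by
  funext x
  have hdet' : det (dir (x + π / 2)) (E x) = 0 := by
    have hderiv := hasDerivAt_det (hasDerivAt_dir x) (hE x)
    simp only [hdet, det_smul_right, det_self, mul_zero, add_zero] at hderiv
    exact hderiv.unique (hasDerivAt_const x 0)
  exact eq_zero_of_det_eq_zero (by simp [det_dir_dir]) (hdet x) hdet'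

end Det

namespace IsUnitCircle

variable {N : Seminorm ℝ (ℝ × ℝ)} {p : ℝ → ℝ × ℝ}

theorem hasDerivAt (hp : IsUnitCircle N p) (x : ℝ) : HasDerivAt p (deriv p x) x :=
  (hp.smooth.differentiable (by simp) x).hasDerivAt

theorem deriv_add_pi (hp : IsUnitCircle N p) (x : ℝ) : deriv p (x + π) = -deriv p x := by
  rw [← deriv_comp_add_const, funext hp.antipodal, deriv.fun_neg]

theorem dualParam_add_pi (hp : IsUnitCircle N p) (x : ℝ) :
    dualParam p (x + π) = -dualParam p x := by
  simp [dualParam, hp.deriv_add_pi, hp.antipodal, det]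

theorem det_dualParam (hp : IsUnitCircle N p) (x : ℝ) : det (p x) (dualParam p x) = 1 := by
  rw [dualParam, det_smul_right, inv_mul_cancel₀ (hp.counterclockwise x).ne']

theorem det_deriv_deriv_pos (hp : IsUnitCircle N p) {x y : ℝ} (hxy : x < y) (hyx : y < x + π) :
    0 < det (deriv p x) (deriv p y) := by
  obtain ⟨ρ, hρ, hx⟩ := hp.tangent x
  obtain ⟨σ, hσ, hy⟩ := hp.tangent y
  rw [hx, hy, det_smul_left, det_smul_right, det_dir_dir]
  exact mul_pos hρ (mul_pos hσ (sin_pos_of_pos_of_lt_pi (by linarith) (by linarith)))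

theorem det_pos (hp : IsUnitCircle N p) {a x : ℝ} (hx : x ∈ Ioo a (a + π)) :
    0 < det (p a) (p x) := by
  by_contra! hle
  have hderiv (y : ℝ) := hasDerivAt_det_const_left (p a) (hp.hasDerivAt y)
  have hcont : Continuous fun y => det (p a) (p y) :=
    continuous_iff_continuousAt.2 fun y => (hderiv y).continuousAt
  have hpi : det (p a) (p (a + π)) = 0 := by rw [hp.antipodal, det_neg_right, det_self, neg_zero]
  obtain ⟨y, ⟨hay, hyx⟩, hy⟩ :=
    exists_hasDerivAt_eq_slope _ _ hx.1 hcont.continuousOn fun y _ => hderiv y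
  obtain ⟨z, ⟨hxz, hza⟩, hz⟩ :=
    exists_hasDerivAt_eq_slope _ _ hx.2 hcont.continuousOn fun y _ => hderiv y
  have hy0 : det (p a) (deriv p y) ≤ 0 := by
    rw [hy, det_self, sub_zero]
    exact div_nonpos_of_nonpos_of_nonneg hle (sub_pos.2 hx.1).le
  have hz0 : 0 ≤ det (p a) (deriv p z) := by
    rw [hz, hpi, zero_sub]
    exact div_nonneg (neg_nonneg.2 hle) (sub_pos.2 hx.2).le
  -- `p' y` is a positive combination of `p' a` and `p' z`, so `[p a, p' y]` should be positive.
  have hcomb := congrArg (det (p a)) (det_smul_eq_cramer (deriv p a) (deriv p z) (deriv p y))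
  rw [det_sub_right, det_smul_right, det_smul_right, det_smul_right,
    det_swap (deriv p y) (deriv p z), neg_mul, sub_neg_eq_add] at hcomb
  have haz := hp.det_deriv_deriv_pos (hay.trans (hyx.trans hxz)) hza
  have hay' := hp.det_deriv_deriv_pos hay (by linarith)
  have hyz := hp.det_deriv_deriv_pos (hyx.trans hxz) (by linarith)
  linarith [mul_nonpos_of_nonneg_of_nonpos haz.le hy0, mul_nonneg hay'.le hz0,
    mul_pos hyz (hp.counterclockwise a)]

variable {Γ : ℝ → ℝ × ℝ} {R : ℝ → ℝ} {c : ℝ}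

theorem exists_sub_add_pi_eq_smul (hp : IsUnitCircle N p)
    (hΓ : ∀ x, HasDerivAt Γ (R x • deriv p x) x) (hw : HasConstantWidth p Γ id) :
    ∃ c : ℝ, ∀ x, Γ x - Γ (x + π) = c • p x := by
  obtain ⟨c, hc⟩ := hw
  choose ρ hρ hρp using hp.tangent
  let E : ℝ → ℝ × ℝ := fun x => Γ x - Γ (x + π) - c • p x
  have hE (x : ℝ) : HasDerivAt E (((R x + R (x + π) - c) * ρ x) • dir x) x := by
    refine (((hΓ x).sub ((hΓ (x + π)).comp_add_const x π)).sub
      ((hp.hasDerivAt x).const_smul c)).congr_deriv ?_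
    rw [hp.deriv_add_pi, hρp]
    module
  have hdual (x : ℝ) : det (E x) (dualParam p x) = 0 := by
    have hwidth : det (Γ x) (dualParam p x) + det (Γ (x + π)) (dualParam p (x + π)) = c :=
      hc x (x + π) rfl
    rw [hp.dualParam_add_pi, det_neg_right] at hwidth
    rw [det_sub_left, det_sub_left, det_smul_left, hp.det_dualParam]
    linarith
  have hdir (x : ℝ) : det (dir x) (E x) = 0 := by
    have hscaled := hdual x
    rw [dualParam, det_smul_right, mul_eq_zero_iff_left (inv_ne_zero (hp.counterclockwise x).ne'),
      hρp, det_smul_right, mul_eq_zero_iff_left (hρ x).ne'] at hscaled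
    rw [det_swap, hscaled, neg_zero]
  exact ⟨c, fun x => sub_eq_zero.1 (congrFun (eq_zero_of_det_dir_eq_zero hE hdir) x)⟩

theorem radius_add_radius_add_pi (hp : IsUnitCircle N p)
    (hΓ : ∀ x, HasDerivAt Γ (R x • deriv p x) x)
    (hc : ∀ x, Γ x - Γ (x + π) = c • p x) (x : ℝ) : R x + R (x + π) = c := by
  have hsub := (hΓ x).sub ((hΓ (x + π)).comp_add_const x π)
  have hderiv : R x • deriv p x - R (x + π) • deriv p (x + π) = c • deriv p x :=
    hsub.unique (((hp.hasDerivAt x).const_smul c).congr_of_eventuallyEq (.of_forall hc))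
  have hdet := congrArg (det (p x)) hderiv
  rw [hp.deriv_add_pi, smul_neg, sub_neg_eq_add, ← add_smul, det_smul_right, det_smul_right]
    at hdet
  exact mul_right_cancel₀ (hp.counterclockwise x).ne' hdet

theorem antiperiodic_deriv_radius (hp : IsUnitCircle N p)
    (hΓ : ∀ x, HasDerivAt Γ (R x • deriv p x) x)
    (hc : ∀ x, Γ x - Γ (x + π) = c • p x) : (deriv R).Antiperiodic π := by
  intro x
  have hR : (fun x => R (x + π)) = fun x => c - R x :=
    funext fun x => eq_sub_of_add_eq' (hp.radius_add_radius_add_pi hΓ hc x)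
  rw [← deriv_comp_add_const, hR, deriv_const_sub]

theorem integral_deriv_radius_mul_det (hp : IsUnitCircle N p) (hR : ContDiff ℝ 1 R)
    (hΓ : ∀ x, HasDerivAt Γ (R x • deriv p x) x)
    (hc : ∀ x, Γ x - Γ (x + π) = c • p x) (a : ℝ) :
    ∫ x in a..(a + π), deriv R x * det (p a) (p x) = 0 := by
  have hprim (x : ℝ) : HasDerivAt (fun x => R x * det (p a) (p x) - det (p a) (Γ x))
      (deriv R x * det (p a) (p x)) x := by
    refine (((hR.differentiable one_ne_zero x).hasDerivAt.mul
      (hasDerivAt_det_const_left (p a) (hp.hasDerivAt x))).sub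
        (hasDerivAt_det_const_left (p a) (hΓ x))).congr_deriv ?_
    rw [det_smul_right, add_sub_cancel_right]
  have hcont : Continuous fun x => deriv R x * det (p a) (p x) :=
    (hR.continuous_deriv le_rfl).mul (contDiff_det contDiff_const hp.smooth).continuous
  calc ∫ x in a..(a + π), deriv R x * det (p a) (p x)
      = R (a + π) * det (p a) (p (a + π)) - det (p a) (Γ (a + π))
          - (R a * det (p a) (p a) - det (p a) (Γ a)) :=
        intervalIntegral.integral_eq_sub_of_hasDerivAt (fun x _ => hprim x)
          (hcont.intervalIntegrable _ _)
    _ = det (p a) (Γ a - Γ (a + π)) := by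
        rw [hp.antipodal, det_neg_right, det_self, det_sub_right]; ring
    _ = 0 := by rw [hc, det_smul_right, det_self, mul_zero]

theorem exists_six_le_encard_zeros_deriv_radius (hp : IsUnitCircle N p) (hR : ContDiff ℝ 1 R)
    (hΓ : ∀ x, HasDerivAt Γ (R x • deriv p x) x)
    (hc : ∀ x, Γ x - Γ (x + π) = c • p x) :
    ∃ a, 6 ≤ (Ico a (a + 2 * π) ∩ deriv R ⁻¹' {0}).encard := by
  have hanti := hp.antiperiodic_deriv_radius hΓ hc
  obtain ⟨a, b, d, hab, hbd, hda, ha, hb, hd⟩ :=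
    exists_three_zeros_of_integral_mul_eq_zero pi_pos (hR.continuous_deriv le_rfl) hanti
      (fun _ => (contDiff_det contDiff_const hp.smooth).continuous.continuousOn)
      (fun _ _ => hp.det_pos) (hp.integral_deriv_radius_mul_det hR hΓ hc)
  exact ⟨a, six_le_encard_zeros_of_antiperiodic hanti hab hbd hda ha hb hd⟩

end IsUnitCircle

section Front

variable {N : Seminorm ℝ (ℝ × ℝ)} {p γ : ℝ → ℝ × ℝ} {θ ψ r : ℝ → ℝ} {T : ℝ}

theorem IsCurvatureRadius.hasDerivAt_comp_of_rightInverse (hr : IsCurvatureRadius p γ θ r)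
    (hγ : Differentiable ℝ γ) (hpθ : Differentiable ℝ (fun t => p (θ t)))
    (hψ : Differentiable ℝ ψ) (hθψ : RightInverse ψ θ) (x : ℝ) :
    HasDerivAt (γ ∘ ψ) ((r ∘ ψ) x • deriv p x) x := by
  have hp : p = (fun t => p (θ t)) ∘ ψ := funext fun x => congrArg p (hθψ x).symm
  have hderiv : deriv p x = deriv ψ x • deriv (fun t => p (θ t)) (ψ x) :=
    (congrArg (deriv · x) hp).trans (deriv.scomp x (hpθ _) (hψ x))
  rw [hderiv, comp_apply, smul_comm, ← hr]
  exact (hγ _).hasDerivAt.scomp x (hψ x).hasDerivAt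

theorem HasConstantWidth.comp (hw : HasConstantWidth p γ θ) (ψ : ℝ → ℝ) :
    HasConstantWidth p (γ ∘ ψ) (θ ∘ ψ) :=
  hw.imp fun _ hc s t h => hc (ψ s) (ψ t) h

/-- The curvature radius `r = [p(θ), γ'] / [p(θ), p(θ)']`, solved from `γ' = r p(θ)'` by taking
the determinant of both sides with `p(θ)`. -/
noncomputable def curvatureRadius (p γ : ℝ → ℝ × ℝ) (θ : ℝ → ℝ) (t : ℝ) : ℝ :=
  det (p (θ t)) (deriv γ t) / det (p (θ t)) (deriv (fun s => p (θ s)) t)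

namespace IsFront

theorem deriv_comp_angle (hγ : IsFront γ θ) (hp : IsUnitCircle N p) (t : ℝ) :
    deriv (fun s => p (θ s)) t = deriv θ t • deriv p (θ t) :=
  ((hp.hasDerivAt (θ t)).scomp t
    (hγ.smooth_angle.differentiable (by simp) t).hasDerivAt).deriv

theorem det_deriv_comp_angle_ne_zero (hγ : IsFront γ θ) (hp : IsUnitCircle N p) (t : ℝ) :
    det (p (θ t)) (deriv (fun s => p (θ s)) t) ≠ 0 := by
  rw [hγ.deriv_comp_angle hp, det_smul_right]
  exact mul_ne_zero (hγ.angle_deriv_ne_zero t) (hp.counterclockwise (θ t)).ne'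

theorem contDiff_curvatureRadius (hγ : IsFront γ θ) (hp : IsUnitCircle N p) :
    ContDiff ℝ ∞ (curvatureRadius p γ θ) := by
  have hpθ : ContDiff ℝ ∞ (fun t => p (θ t)) := hp.smooth.comp hγ.smooth_angle
  exact (contDiff_det hpθ (contDiff_infty_iff_deriv.1 hγ.smooth).2).div
    (contDiff_det hpθ (contDiff_infty_iff_deriv.1 hpθ).2) (hγ.det_deriv_comp_angle_ne_zero hp)

theorem isCurvatureRadius (hγ : IsFront γ θ) (hp : IsUnitCircle N p) :
    IsCurvatureRadius p γ θ (curvatureRadius p γ θ) := by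
  intro t
  have hne := hγ.det_deriv_comp_angle_ne_zero hp t
  have hparallel : det (deriv (fun s => p (θ s)) t) (deriv γ t) = 0 := by
    obtain ⟨ρ, -, hρ⟩ := hp.tangent (θ t)
    rw [hγ.deriv_comp_angle hp, hρ, det_smul_left, det_smul_left, hγ.legendrian, mul_zero,
      mul_zero]
  have hcramer := det_smul_eq_cramer (p (θ t)) (deriv (fun s => p (θ s)) t) (deriv γ t)
  rw [hparallel, zero_smul, sub_zero] at hcramer
  rw [curvatureRadius, div_eq_inv_mul, mul_smul, ← hcramer, inv_smul_smul₀ hne]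

end IsFront

namespace IsClosedFront

theorem exists_turning_number (hγ : IsClosedFront γ θ T) :
    ∃ n : ℤ, n ≠ 0 ∧ ∀ t, θ (t + T) = θ t + n • (2 * π) := by
  have hθ := hγ.smooth_angle.continuous
  have hcont : Continuous fun t => θ (t + T) - θ t := by fun_prop
  have hsq : EqOn ((fun t => θ (t + T) - θ t) ^ 2) ((fun _ => 2 * π) ^ 2) univ := fun t _ => by
    simp only [Pi.pow_apply]
    rw [← sq_abs, hγ.one_turn]
  rcases isPreconnected_univ.eq_or_eq_neg_of_sq_eq hcont.continuousOn continuousOn_const hsq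
    (fun _ => two_pi_pos.ne') with h | h
  · exact ⟨1, one_ne_zero, fun t => by
      rw [one_zsmul]; exact eq_add_of_sub_eq' (h (mem_univ t))⟩
  · exact ⟨-1, by decide, fun t => by
      rw [neg_one_zsmul]; exact eq_add_of_sub_eq' (h (mem_univ t))⟩

theorem surjective_angle (hγ : IsClosedFront γ θ T) : Surjective θ := by
  obtain ⟨n, hn, hturn⟩ := hγ.exists_turning_number
  exact surjective_of_map_add_eq hγ.smooth_angle.continuous (by simp [hn, pi_ne_zero]) hturn

theorem encard_zeros_deriv_le_encard_vertices_comp (hγ : IsClosedFront γ θ T) {R : ℝ → ℝ}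
    (hR : Differentiable ℝ R) (hper : (deriv R).Periodic (2 * π)) (a : ℝ) :
    (Ico a (a + 2 * π) ∩ deriv R ⁻¹' {0}).encard ≤ (vertices (R ∘ θ) T).encard := by
  obtain ⟨n, -, hturn⟩ := hγ.exists_turning_number
  refine (encard_Ico_inter_preimage_le_of_surjective hγ.period_pos two_pi_pos hper
    hγ.surjective_angle hturn {0} a 0).trans (encard_le_encard ?_)
  rintro t ⟨htT, ht : deriv R (θ t) = 0⟩
  rw [zero_add] at htT
  refine ⟨htT, ?_⟩
  rw [deriv_comp t (hR _) (hγ.smooth_angle.differentiable (by simp) t), ht, zero_mul]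

end IsClosedFront

end Front

end NormedPlane

theorem mainTheorem9 (N : Seminorm ℝ (ℝ × ℝ)) (p : ℝ → ℝ × ℝ)
    (hp : NormedPlane.IsUnitCircle N p)
    (γ : ℝ → ℝ × ℝ) (θ : ℝ → ℝ) (T : ℝ)
    (hγ : NormedPlane.IsClosedFront γ θ T)
    (hw : NormedPlane.HasConstantWidth p γ θ) :
    ∃ r : ℝ → ℝ, ContDiff ℝ ∞ r ∧ NormedPlane.IsCurvatureRadius p γ θ r ∧
      6 ≤ (NormedPlane.vertices r T).encard := by
  let r := NormedPlane.curvatureRadius p γ θ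
  have hr : ContDiff ℝ ∞ r := hγ.contDiff_curvatureRadius hp
  have hrad : NormedPlane.IsCurvatureRadius p γ θ r := hγ.isCurvatureRadius hp
  obtain ⟨ψ, hψ, hψθ, hθψ⟩ := NormedPlane.exists_contDiff_inverse (by simp) hγ.smooth_angle
    hγ.angle_deriv_ne_zero hγ.surjective_angle
  have hR : ContDiff ℝ 1 (r ∘ ψ) := (hr.comp hψ).of_le (by simp)
  have hΓ := hrad.hasDerivAt_comp_of_rightInverse (hγ.smooth.differentiable (by simp))
    ((hp.smooth.comp hγ.smooth_angle).differentiable (by simp)) (hψ.differentiable (by simp)) hθψ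
  obtain ⟨c, hc⟩ := hp.exists_sub_add_pi_eq_smul hΓ (hθψ.comp_eq_id ▸ hw.comp ψ)
  obtain ⟨a, ha⟩ := hp.exists_six_le_encard_zeros_deriv_radius hR hΓ hc
  have hper := (hp.antiperiodic_deriv_radius hΓ hc).periodic_two_mul
  have hRθ : (r ∘ ψ) ∘ θ = r := by rw [Function.comp_assoc, hψθ.comp_eq_id, Function.comp_id]
  refine ⟨r, hr, hrad, hRθ ▸ ha.trans ?_⟩
  exact hγ.encard_zeros_deriv_le_encard_vertices_comp (hR.differentiable one_ne_zero) hper a
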